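/- Let $\Omega\subset\mathbb{R}^2$ be a bounded open set. A regular closed curve is a map $\gamma:\mathbb{R}/\mathbb{Z}\to\mathbb{R}^2$ of class $H^2$ with $|\gamma'|>0$ everywhere; it is admissible if its image lies in $\overline\Omega$ and all its self-intersections are tangential (whenever $\gamma(t)=\gamma(s)$, the vectors $\gamma'(t)$ and $\gamma'(s)$ are parallel). For an arc let $\mathcal W(\gamma_{|[a,b]})=\int_a^b\kappa^2|\gamma'|\,dt$, where $\kappa$ is the curvature, and let $\mathcal W(\gamma)$ be this energy for the whole curve. Let $\gamma$ be a minimizer of $\mathcal W$ among all admissible curves, parametrized with constant speed and regarded as a $1$-periodic map on $\mathbb{R}$. Call $(t,s)$ a self-contact couple if $t<s<t+1$ and $\gamma(t)=\gamma(s)$; let $\mathcal C$ be the set of times belonging to such a couple (modulo $1$), and call the points of $\gamma(\mathcal C)$ self-contact points. Then: 1. Every self-contact point has multiplicity at most $2$, i.e. every point of the plane is attained by $\gamma$ at no more than two times modulo $1$. 2. If $(t,s)$ is a self-contact couple, then $\gamma'(s)=-\gamma'(t)$. 3. Self-contact couples do not cross: there are no self-contact couples $(t_1,s_1)$, $(t_2,s_2)$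 with $t_1<t_2<s_1<s_2<t_1+1$. 4. Self-contact couples are nested: given three distinct self-contact points, one can label them $x_1,x_2,x_3$ and find times $t_1<t_2<t_3<s_3<s_2<s_1<t_1+1$ with $\gamma(t_i)=\gamma(s_i)=x_i$ for $i=1,2,3$. 5. If $\gamma$ has at least two distinct self-contact points, then there exist times $t<s<\tau<\sigma<t+1$ such that - $(t,s)$ and $(\tau,\sigma)$ are self-contact couples; - $]t,s[\,\cap\,\mathcal C=\emptyset$ and $]\tau,\sigma[\,\cap\,\mathcal C=\emptyset$; - $\gamma$ is injective on $]s,\tau[$ and on $]\sigma,t+1[$, and $\mathcal W(\gamma_{|[s,\tau]})=\mathcal W(\gamma_{|[\sigma,t+1]})$; - for all $a\in\,]s,\tau[$ and $b\in\,]\sigma,t+1[$ with $\gamma(a)=\gamma(b)$, one has $\mathcal W(\gamma_{|[s,a]})=\mathcal W(\gamma_{|[b,t+1]})$ and $\mathcal W(\gamma_{|[a,\tau]})=\mathcal W(\gamma_{|[\sigma,b]})$; - if moreover $a<a'$ in $]s,\tau[$ and $b,b'\in\,]\sigma,t+1[$ satisfy $\gamma(a)=\gamma(b)$ and $\gamma(a')=\gamma(b')$,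 then $b'<b$ and $\mathcal W(\gamma_{|[a,a']})=\mathcal W(\gamma_{|[b',b]})$. -/

import Mathlib

open Set MeasureTheory

namespace ConfinedElastica

/-- The Euclidean plane. -/
abbrev Plane : Type := EuclideanSpace ℝ (Fin 2)

/-- Regular closed curves of class `H²`, as `1`-periodic maps of the real line, that is, as maps of
the circle `ℝ / ℤ`. In one dimension a function is in `H²` if and only if (its continuous
representative) is continuously differentiable with an absolutely continuous derivative whose
almost everywhere defined derivative, which is the second distributional derivative, is square
integrable. -/
structure IsRegularClosedCurve (γ : ℝ → Plane) : Prop where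
  periodic : Function.Periodic γ 1
  contDiff : ContDiff ℝ 1 γ
  absolutelyContinuous : AbsolutelyContinuousOnInterval (deriv γ) 0 1
  memLp : MemLp (deriv (deriv γ)) 2 (volume.restrict (Ioc (0 : ℝ) 1))
  regular : ∀ t, 0 < ‖deriv γ t‖

/-- The (signed) curvature `(x' y'' - y' x'') / |γ'| ^ 3` of a parametrized curve, at almost every
parameter. -/
noncomputable def curvature (γ : ℝ → Plane) (t : ℝ) : ℝ :=
  (deriv γ t 0 * deriv (deriv γ) t 1 - deriv γ t 1 * deriv (deriv γ) t 0) / ‖deriv γ t‖ ^ 3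

/-- The bending energy `∫ κ ^ 2 ds` of the arc of `γ` with parameters in `[a, b]`, where
`ds = |γ'| dt` is the arc-length element. In an arc-length parametrization this is `∫ |γ''| ^ 2`. -/
noncomputable def arcEnergy (γ : ℝ → Plane) (a b : ℝ) : ℝ :=
  ∫ t in a..b, curvature γ t ^ 2 * ‖deriv γ t‖

/-- The bending energy of a closed curve. -/
noncomputable def bendingEnergy (γ : ℝ → Plane) : ℝ := arcEnergy γ 0 1

/-- Admissible curves: regular closed curves confined in `Ω` whose self-intersections (if any) are
all tangential, i.e. the velocities there are parallel. -/
structure IsAdmissible (Ω : Set Plane) (γ : ℝ → Plane) : Prop where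
  regularClosed : IsRegularClosedCurve γ
  confined : range γ ⊆ closure Ω
  tangential : ∀ t s, γ t = γ s → ∃ c : ℝ, deriv γ s = c • deriv γ t

/-- Minimizers of the bending energy among all admissible curves. -/
def IsMinimal (Ω : Set Plane) (γ : ℝ → Plane) : Prop :=
  IsAdmissible Ω γ ∧ ∀ η : ℝ → Plane, IsAdmissible Ω η → bendingEnergy γ ≤ bendingEnergy η

/-- `(t, s)` is a self-contact couple: two ordered times `t < s`, distinct modulo `1`, at which the
curve passes through the same point. -/
def IsContactCouple (γ : ℝ → Plane) (t s : ℝ) : Prop :=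
  t < s ∧ s < t + 1 ∧ γ t = γ s

/-- The set of self-contact times. For a `1`-periodic curve, any partner `s` of `t` that is distinct
from `t` modulo `1` can be shifted into `(t, t + 1)`. -/
def contactTimes (γ : ℝ → Plane) : Set ℝ := {t | ∃ s, IsContactCouple γ t s}

/-- The set of self-contact points (self-intersections) in the plane. -/
def contactPoints (γ : ℝ → Plane) : Set Plane := γ '' contactTimes γ

end ConfinedElastica

/-! The proof is cut and paste. A closed path that runs along pieces of `γ`, in either direction and
possibly repeatedly, is again admissible if position and velocity match at each junction: its points
and tangent lines are those of `γ`, so it inherits confinement and tangential contacts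
(`IsArc.exists_isAdmissible`). Its energy, the sum of the energies of its pieces, is therefore at
least that of `γ` (`IsMinimal.bendingEnergy_le`), which is positive.

If the velocities agreed at a contact, each of the two loops cut there would be a competitor, and
together they have the energy of `γ`: impossible. So velocities are opposite (`deriv_eq_neg`), which
forbids triple points. Crossing couples would also split `γ` into two competitors, after reversing
two of the four arcs (`not_crossing`). For two disjoint drops, traversing one joining branch twice
and dropping the other gives a competitor; as either branch can be kept, both have equal energy
(`arcEnergy_eq_of_contact`). With three disjoint drops these equalities force the total energy to
vanish (`not_three_drops`). Nesting, injectivity of the branches and all energy identities follow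
from these facts. -/

namespace ConfinedElastica

/-! ### Energy density under reversal and rescaling -/

/-- The energy density of a curve with velocity `u` and acceleration `w`. -/
noncomputable def energyDensity (u w : Plane) : ℝ :=
  ((u 0 * w 1 - u 1 * w 0) / ‖u‖ ^ 3) ^ 2 * ‖u‖

lemma energyDensity_neg_left (u w : Plane) : energyDensity (-u) w = energyDensity u w := by
  simp only [energyDensity, PiLp.neg_apply, norm_neg]
  ring

lemma energyDensity_smul {c : ℝ} (hc : 0 < c) (u w : Plane) :
    energyDensity (c • u) (c ^ 2 • w) = c * energyDensity u w := by
  rcases eq_or_ne u 0 with rfl | hu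
  · simp [energyDensity]
  have hu' : ‖u‖ ≠ 0 := norm_ne_zero_iff.2 hu
  simp only [energyDensity, PiLp.smul_apply, norm_smul, smul_eq_mul, Real.norm_of_nonneg hc.le]
  field_simp

/-! ### Concatenation of functions and their integrals -/

/-- The function equal to `f` up to `c` and to the translate of `g` after `c`. -/
noncomputable def glue {F : Type*} (c : ℝ) (f g : ℝ → F) (t : ℝ) : F :=
  if t ≤ c then f t else g (t - c)

section glue

variable {F : Type*} {c d t : ℝ} {f g : ℝ → F}

lemma glue_of_le (h : t ≤ c) : glue c f g t = f t := if_pos h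

lemma glue_of_lt (h : c < t) : glue c f g t = g (t - c) := if_neg h.not_ge

variable [NormedAddCommGroup F]

lemma intervalIntegrable_glue (hc : 0 ≤ c) (hd : 0 ≤ d)
    (hf : IntervalIntegrable f volume 0 c) (hg : IntervalIntegrable g volume 0 d) :
    IntervalIntegrable (glue c f g) volume 0 (c + d) := by
  refine IntervalIntegrable.trans (b := c) (hf.congr fun s hs ↦ ?_) ?_
  · rw [uIoc_of_le hc] at hs
    exact (glue_of_le hs.2).symm
  · have h := hg.comp_sub_right c
    rw [zero_add, add_comm d] at h
    refine h.congr fun s hs ↦ ?_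
    rw [uIoc_of_le (by linarith)] at hs
    exact (glue_of_lt hs.1).symm

variable [NormedSpace ℝ F]

lemma integral_glue_of_le (ht : 0 ≤ t) (htc : t ≤ c) :
    ∫ s in (0 : ℝ)..t, glue c f g s = ∫ s in (0 : ℝ)..t, f s := by
  refine intervalIntegral.integral_congr fun s hs ↦ ?_
  rw [uIcc_of_le ht] at hs
  exact glue_of_le (hs.2.trans htc)

lemma integral_glue_of_ge (hc : 0 ≤ c) (hct : c ≤ t) (htd : t ≤ c + d)
    (hf : IntervalIntegrable f volume 0 c) (hg : IntervalIntegrable g volume 0 d) :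
    ∫ s in (0 : ℝ)..t, glue c f g s
      = (∫ s in (0 : ℝ)..c, f s) + ∫ s in (0 : ℝ)..(t - c), g s := by
  have hd : 0 ≤ d := by linarith
  have hi := intervalIntegrable_glue hc hd hf hg
  rw [← intervalIntegral.integral_add_adjacent_intervals (b := c)
    (hi.mono_set (by rw [uIcc_of_le hc, uIcc_of_le (by linarith)]
                     exact Icc_subset_Icc le_rfl (by linarith)))
    (hi.mono_set (by rw [uIcc_of_le hct, uIcc_of_le (by linarith)]
                     exact Icc_subset_Icc hc htd)),
    integral_glue_of_le hc le_rfl]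
  congr 1
  have h := intervalIntegral.integral_comp_sub_right (a := c) (b := t) g c
  rw [sub_self] at h
  rw [← h]
  -- The half-open interval omits `c`, where `glue` takes the value of `f`; hence `f c = g 0` is not
  -- needed.
  refine intervalIntegral.integral_congr_ae (.of_forall fun s hs ↦ ?_)
  rw [uIoc_of_le hct] at hs
  exact glue_of_lt hs.1

end glue

/-! ### Arcs along the curve: concatenation and reversal -/

/-- An arc of class `H²` on `[0, ℓ]`, with position `x`, velocity `u` and acceleration `w`, which
follows the curve `γ` up to orientation. -/
structure IsArc (γ : ℝ → Plane) (ℓ : ℝ) (x u w : ℝ → Plane) : Prop where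
  length_pos : 0 < ℓ
  intervalIntegrable_accel : IntervalIntegrable w volume 0 ℓ
  intervalIntegrable_sq : IntervalIntegrable (fun t ↦ ‖w t‖ ^ 2) volume 0 ℓ
  intervalIntegrable_vel : IntervalIntegrable u volume 0 ℓ
  intervalIntegrable_density : IntervalIntegrable (fun t ↦ energyDensity (u t) (w t)) volume 0 ℓ
  vel_eq : ∀ t ∈ Icc 0 ℓ, u t = u 0 + ∫ s in (0 : ℝ)..t, w s
  pos_eq : ∀ t ∈ Icc 0 ℓ, x t = x 0 + ∫ s in (0 : ℝ)..t, u s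
  trace : ∀ t ∈ Icc 0 ℓ, ∃ r, x t = γ r ∧ (u t = deriv γ r ∨ u t = -deriv γ r)

/-- There is an arc following `γ` up to orientation, from the point `p` with velocity `v` to the
point `q` with velocity `z`, of energy `E`. -/
def HasArc (γ : ℝ → Plane) (p v q z : Plane) (E : ℝ) : Prop :=
  ∃ ℓ x u w, IsArc γ ℓ x u w ∧ x 0 = p ∧ u 0 = v ∧ x ℓ = q ∧ u ℓ = z ∧
    ∫ t in (0 : ℝ)..ℓ, energyDensity (u t) (w t) = E

variable {γ : ℝ → Plane} {p v q z p' v' : Plane} {E E' : ℝ}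

/-- Position and velocity match at the junction, so both remain primitives. The acceleration may
jump there, which is harmless in `H²`. -/
lemma HasArc.trans (h : HasArc γ p v q z E) (h' : HasArc γ q z p' v' E') :
    HasArc γ p v p' v' (E + E') := by
  obtain ⟨c, x, u, w, h, rfl, rfl, hx, hu, rfl⟩ := h
  obtain ⟨d, X, U, W, H, hX, hU, rfl, rfl, rfl⟩ := h'
  have hc := h.length_pos
  have hd := H.length_pos
  have hcd : c < c + d := by linarith
  have hρ : (fun t ↦ energyDensity (glue c u U t) (glue c w W t))
      = glue c (fun t ↦ energyDensity (u t) (w t)) (fun t ↦ energyDensity (U t) (W t)) := by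
    funext t
    unfold glue
    split_ifs <;> rfl
  refine ⟨c + d, glue c x X, glue c u U, glue c w W, ?_, glue_of_le hc.le, glue_of_le hc.le,
    ?_, ?_, ?_⟩
  · refine ⟨by linarith, intervalIntegrable_glue hc.le hd.le h.2 H.2, ?_,
      intervalIntegrable_glue hc.le hd.le h.4 H.4, ?_, fun t ht ↦ ?_, fun t ht ↦ ?_,
      fun t ht ↦ ?_⟩
    · have e : (fun t ↦ ‖glue c w W t‖ ^ 2)
          = glue c (fun t ↦ ‖w t‖ ^ 2) (fun t ↦ ‖W t‖ ^ 2) := by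
        funext t
        unfold glue
        split_ifs <;> rfl
      rw [e]
      exact intervalIntegrable_glue hc.le hd.le h.3 H.3
    · rw [hρ]
      exact intervalIntegrable_glue hc.le hd.le h.5 H.5
    · rw [glue_of_le hc.le]
      rcases le_or_gt t c with htc | htc
      · rw [glue_of_le htc, integral_glue_of_le ht.1 htc, ← h.vel_eq t ⟨ht.1, htc⟩]
      · rw [glue_of_lt htc, integral_glue_of_ge hc.le htc.le ht.2 h.2 H.2, ← add_assoc,
          ← h.vel_eq c ⟨hc.le, le_rfl⟩, hu, ← hU]
        exact H.vel_eq _ ⟨by linarith, by linarith [ht.2]⟩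
    · rw [glue_of_le hc.le]
      rcases le_or_gt t c with htc | htc
      · rw [glue_of_le htc, integral_glue_of_le ht.1 htc, ← h.pos_eq t ⟨ht.1, htc⟩]
      · rw [glue_of_lt htc, integral_glue_of_ge hc.le htc.le ht.2 h.4 H.4, ← add_assoc,
          ← h.pos_eq c ⟨hc.le, le_rfl⟩, hx, ← hX]
        exact H.pos_eq _ ⟨by linarith, by linarith [ht.2]⟩
    · rcases le_or_gt t c with htc | htc
      · rw [glue_of_le htc, glue_of_le htc]
        exact h.trace t ⟨ht.1, htc⟩
      · rw [glue_of_lt htc, glue_of_lt htc]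
        exact H.trace _ ⟨by linarith, by linarith [ht.2]⟩
  · rw [glue_of_lt hcd, add_sub_cancel_left]
  · rw [glue_of_lt hcd, add_sub_cancel_left]
  · rw [hρ, integral_glue_of_ge hc.le hcd.le le_rfl h.5 H.5, add_sub_cancel_left]

/-- Reversing time flips the velocity and leaves the acceleration unchanged; the density is even in
the velocity. -/
lemma HasArc.reverse (h : HasArc γ p v q z E) : HasArc γ q (-z) p (-v) E := by
  obtain ⟨ℓ, x, u, w, h, rfl, rfl, rfl, rfl, rfl⟩ := h
  have hℓ := h.length_pos
  have hint {F : Type} [NormedAddCommGroup F] {f : ℝ → F} (hf : IntervalIntegrable f volume 0 ℓ) :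
      IntervalIntegrable (fun t ↦ f (ℓ - t)) volume 0 ℓ := by
    have := hf.comp_sub_left ℓ
    rw [sub_zero, sub_self] at this
    exact this.symm
  have hrev (f : ℝ → Plane) (hf : IntervalIntegrable f volume 0 ℓ) (t : ℝ) (ht : t ∈ Icc 0 ℓ) :
      ∫ s in (0 : ℝ)..t, f (ℓ - s) = (∫ s in (0 : ℝ)..ℓ, f s) - ∫ s in (0 : ℝ)..(ℓ - t), f s := by
    rw [intervalIntegral.integral_comp_sub_left f ℓ, sub_zero,
      intervalIntegral.integral_interval_sub_left hf]
    refine hf.mono_set ?_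
    rw [uIcc_of_le (by linarith [ht.2]), uIcc_of_le hℓ.le]
    exact Icc_subset_Icc le_rfl (by linarith [ht.1])
  have hmem (t : ℝ) (ht : t ∈ Icc 0 ℓ) : ℓ - t ∈ Icc 0 ℓ :=
    ⟨by linarith [ht.2], by linarith [ht.1]⟩
  refine ⟨ℓ, fun t ↦ x (ℓ - t), fun t ↦ -u (ℓ - t), fun t ↦ w (ℓ - t), ?_, by simp, by simp,
    by simp, by simp, ?_⟩
  · refine ⟨hℓ, hint h.2, hint h.3, (hint h.4).neg, ?_, fun t ht ↦ ?_, fun t ht ↦ ?_,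
      fun t ht ↦ ?_⟩
    · simp only [energyDensity_neg_left]
      exact hint h.5
    · rw [hrev w h.2 t ht, sub_zero, h.vel_eq _ (hmem t ht), h.vel_eq ℓ ⟨hℓ.le, le_rfl⟩]
      abel
    · rw [intervalIntegral.integral_neg, hrev u h.4 t ht, sub_zero, h.pos_eq _ (hmem t ht),
        h.pos_eq ℓ ⟨hℓ.le, le_rfl⟩]
      abel
    · obtain ⟨r, hr, hu⟩ := h.trace _ (hmem t ht)
      refine ⟨r, hr, ?_⟩
      rcases hu with hu | hu
      · exact .inr (by rw [hu])
      · exact .inl (by rw [hu, neg_neg])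
  · simp only [energyDensity_neg_left]
    rw [intervalIntegral.integral_comp_sub_left (fun t ↦ energyDensity (u t) (w t)) ℓ]
    simp

/-! ### Closing an arc up to an admissible competitor -/

lemma absolutelyContinuousOnInterval_integral {F : Type*} [NormedAddCommGroup F]
    [NormedSpace ℝ F] {f : ℝ → F} (hf : ∀ a b, IntervalIntegrable f volume a b) (a b c : ℝ) :
    AbsolutelyContinuousOnInterval (fun t ↦ ∫ s in c..t, f s) a b := by
  have h := (hf a b).norm.absolutelyContinuousOnInterval_intervalIntegral (c := a) (by simp)
  refine squeeze_zero (fun _ ↦ Finset.sum_nonneg fun _ _ ↦ dist_nonneg)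
    (fun I ↦ Finset.sum_le_sum fun i _ ↦ ?_) h
  rw [dist_eq_norm, Real.dist_eq,
    intervalIntegral.integral_interval_sub_left (hf _ _) (hf _ _),
    intervalIntegral.integral_interval_sub_left (hf _ _).norm (hf _ _).norm]
  exact intervalIntegral.norm_integral_le_abs_integral_norm

/-- A closed arc following an admissible curve closes up to an admissible curve. -/
lemma IsArc.exists_isAdmissible {Ω : Set Plane} {γ : ℝ → Plane} {ℓ : ℝ} {x u w : ℝ → Plane}
    (hγ : IsAdmissible Ω γ) (h : IsArc γ ℓ x u w) (hx : x ℓ = x 0) (hu : u ℓ = u 0) :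
    ∃ η, IsAdmissible Ω η ∧
      bendingEnergy η = ∫ t in (0 : ℝ)..ℓ, energyDensity (u t) (w t) := by
  have hℓ := h.length_pos
  -- The competitor is rebuilt from its acceleration, rescaled to period `1` and extended
  -- periodically, then integrated twice. `toIocMod` uses representatives in `(0, 1]`, the interval
  -- of integration.
  set W : ℝ → Plane := fun t ↦ ℓ ^ 2 • w (ℓ * toIocMod one_pos 0 t) with hW
  have hWper : Function.Periodic W 1 := fun t ↦ by simp only [hW, toIocMod_add_right]
  have hWeq : ∀ t ∈ Ioc (0 : ℝ) 1, W t = ℓ ^ 2 • w (ℓ * t) := fun t ht ↦ by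
    simp only [hW]
    rw [(toIocMod_eq_self one_pos).2 (by simpa using ht)]
  have hscale {F : Type} [NormedAddCommGroup F] {f : ℝ → F} (hf : IntervalIntegrable f volume 0 ℓ) :
      IntervalIntegrable (fun t ↦ f (ℓ * t)) volume 0 1 := by
    have := hf.comp_mul_left (c := ℓ)
    rwa [zero_div, div_self hℓ.ne'] at this
  have hWint01 : IntervalIntegrable W volume 0 1 := by
    refine ((hscale h.2).smul (ℓ ^ 2)).congr fun t ht ↦ ?_
    rw [uIoc_of_le zero_le_one] at ht
    exact (hWeq t ht).symm
  have hWint : ∀ a b, IntervalIntegrable W volume a b := hWper.intervalIntegrable₀ one_ne_zero hWint01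
  set U : ℝ → Plane := fun t ↦ ℓ • u 0 + ∫ s in (0 : ℝ)..t, W s with hU
  have hUcont : Continuous U :=
    continuous_const.add (intervalIntegral.continuous_primitive hWint 0)
  have hUeq : ∀ t ∈ Icc (0 : ℝ) 1, U t = ℓ • u (ℓ * t) := fun t ht ↦ by
    have e : ∫ s in (0 : ℝ)..t, W s = ∫ s in (0 : ℝ)..t, ℓ ^ 2 • w (ℓ * s) := by
      refine intervalIntegral.integral_congr_ae (.of_forall fun s hs ↦ ?_)
      rw [uIoc_of_le ht.1] at hs
      exact hWeq s ⟨hs.1, hs.2.trans ht.2⟩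
    rw [h.vel_eq (ℓ * t) ⟨by have := ht.1; positivity, by nlinarith [ht.2]⟩]
    simp only [hU]
    rw [e, intervalIntegral.integral_smul, intervalIntegral.integral_comp_mul_left _ hℓ.ne',
      mul_zero, smul_smul, smul_add]
    congr 2
    field_simp
  -- A primitive of a periodic function is periodic when the mean vanishes; here this is `u ℓ = u
  -- 0`, and for `X` below it is `x ℓ = x 0`.
  have hUper : Function.Periodic U 1 := fun t ↦ by
    have h1 : ∫ s in (0 : ℝ)..1, W s = 0 := by
      have := hUeq 1 ⟨zero_le_one, le_rfl⟩
      rw [mul_one, hu] at this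
      simpa [hU] using this
    have h2 := hWper.intervalIntegral_add_eq t 0
    rw [zero_add, h1] at h2
    simp only [hU]
    rw [← intervalIntegral.integral_add_adjacent_intervals (hWint 0 t) (hWint t (t + 1)), h2,
      add_zero]
  have hUint : ∀ a b, IntervalIntegrable U volume a b := hUcont.intervalIntegrable
  set X : ℝ → Plane := fun t ↦ x 0 + ∫ s in (0 : ℝ)..t, U s with hX
  have hXder : ∀ t, HasDerivAt X (U t) t := fun t ↦
    (intervalIntegral.integral_hasDerivAt_right (hUint 0 t)
      (hUcont.stronglyMeasurableAtFilter _ _) hUcont.continuousAt).const_add _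
  have hderiv : deriv X = U := funext fun t ↦ (hXder t).deriv
  have hXeq : ∀ t ∈ Icc (0 : ℝ) 1, X t = x (ℓ * t) := fun t ht ↦ by
    have e : ∫ s in (0 : ℝ)..t, U s = ∫ s in (0 : ℝ)..t, ℓ • u (ℓ * s) := by
      refine intervalIntegral.integral_congr fun s hs ↦ ?_
      rw [uIcc_of_le ht.1] at hs
      exact hUeq s ⟨hs.1, hs.2.trans ht.2⟩
    rw [h.pos_eq (ℓ * t) ⟨by have := ht.1; positivity, by nlinarith [ht.2]⟩]
    simp only [hX]
    rw [e, intervalIntegral.integral_smul, intervalIntegral.integral_comp_mul_left _ hℓ.ne',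
      mul_zero, smul_smul, mul_inv_cancel₀ hℓ.ne', one_smul]
  have hXper : Function.Periodic X 1 := fun t ↦ by
    have h1 : ∫ s in (0 : ℝ)..1, U s = 0 := by
      have := hXeq 1 ⟨zero_le_one, le_rfl⟩
      rw [mul_one, hx] at this
      simpa [hX] using this
    have h2 := hUper.intervalIntegral_add_eq t 0
    rw [zero_add, h1] at h2
    simp only [hX]
    rw [← intervalIntegral.integral_add_adjacent_intervals (hUint 0 t) (hUint t (t + 1)), h2,
      add_zero]
  have hUW : ∀ᵐ t, t ∈ Ioc (0 : ℝ) 1 → deriv U t = W t := by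
    filter_upwards [hWint01.ae_hasDerivAt_integral] with t ht htm
    have hm : t ∈ uIcc (0 : ℝ) 1 := by
      rw [uIcc_of_le zero_le_one]
      exact Ioc_subset_Icc_self htm
    exact ((ht hm 0 (by simp)).const_add _).deriv
  -- This yields regularity, confinement and tangential contacts at once: everything is read off
  -- `γ`, with velocities multiplied by `±ℓ`.
  have htrace : ∀ t, ∃ r, X t = γ r ∧ ∃ c : ℝ, c ≠ 0 ∧ U t = c • deriv γ r := fun t ↦ by
    have hper : Function.Periodic (fun t ↦ (X t, U t)) 1 := fun t ↦ by
      simp only [hXper t, hUper t]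
    obtain ⟨y, hy, hty⟩ := hper.exists_mem_Ico₀ one_pos t
    obtain ⟨hX1, hU1⟩ := Prod.mk.inj hty
    have hy' := Ico_subset_Icc_self hy
    obtain ⟨r, hr, hur⟩ := h.trace (ℓ * y)
      ⟨by have := hy.1; positivity, by nlinarith [hy.2]⟩
    refine ⟨r, by rw [hX1, hXeq y hy', hr], ?_⟩
    rcases hur with hur | hur
    · exact ⟨ℓ, hℓ.ne', by rw [hU1, hUeq y hy', hur]⟩
    · exact ⟨-ℓ, neg_ne_zero.2 hℓ.ne', by rw [hU1, hUeq y hy', hur, smul_neg, neg_smul]⟩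
  refine ⟨X, ⟨⟨hXper, ?_, ?_, ?_, fun t ↦ ?_⟩, ?_, fun t s hts ↦ ?_⟩, ?_⟩
  · rw [contDiff_one_iff_deriv, hderiv]
    exact ⟨fun t ↦ (hXder t).differentiableAt, hUcont⟩
  · rw [hderiv]
    exact (LipschitzOnWith.absolutelyContinuousOnInterval (K := 0)
      (LipschitzWith.const _).lipschitzOnWith).add
        (absolutelyContinuousOnInterval_integral hWint 0 1 0)
  · rw [hderiv]
    have hae : W =ᵐ[volume.restrict (Ioc (0 : ℝ) 1)] deriv U := by
      rw [Filter.EventuallyEq, ae_restrict_iff' measurableSet_Ioc]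
      filter_upwards [hUW] with t ht htm using (ht htm).symm
    refine MemLp.ae_eq hae ?_
    rw [memLp_two_iff_integrable_sq_norm hWint01.1.1]
    have h3 := ((hscale h.3).const_mul (ℓ ^ 4)).1
    refine h3.congr_fun (fun t ht ↦ ?_) measurableSet_Ioc
    simp only [hWeq t ht, norm_smul, norm_pow, Real.norm_of_nonneg hℓ.le]
    ring
  · rw [hderiv, norm_pos_iff]
    obtain ⟨r, -, c, hc, hr⟩ := htrace t
    rw [hr]
    exact smul_ne_zero hc (norm_pos_iff.1 (hγ.regularClosed.regular r))
  · rintro _ ⟨t, rfl⟩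
    obtain ⟨r, hr, -⟩ := htrace t
    rw [hr]
    exact hγ.confined ⟨r, rfl⟩
  · rw [hderiv]
    obtain ⟨r, hr, c, hc, hur⟩ := htrace t
    obtain ⟨r', hr', c', -, hur'⟩ := htrace s
    obtain ⟨k, hk⟩ := hγ.tangential r r' (by rw [← hr, ← hr', hts])
    refine ⟨c' * k * c⁻¹, ?_⟩
    rw [hur, hur', hk, smul_smul, smul_smul]
    congr 1
    field_simp
  · have e : ∀ᵐ t, t ∈ uIoc (0 : ℝ) 1 → curvature X t ^ 2 * ‖deriv X t‖
        = ℓ * energyDensity (u (ℓ * t)) (w (ℓ * t)) := by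
      filter_upwards [hUW] with t ht htm
      rw [uIoc_of_le zero_le_one] at htm
      rw [← energyDensity_smul hℓ, curvature, hderiv, ht htm, hWeq t htm,
        hUeq t (Ioc_subset_Icc_self htm)]
      rfl
    rw [bendingEnergy, arcEnergy, intervalIntegral.integral_congr_ae e,
      intervalIntegral.integral_const_mul,
      intervalIntegral.integral_comp_mul_left (fun t ↦ energyDensity (u t) (w t)) hℓ.ne', smul_eq_mul,
      ← mul_assoc, mul_inv_cancel₀ hℓ.ne', one_mul, mul_zero, mul_one]

/-- The only form in which minimality is used below: every closed path along `γ` is a competitor. -/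
lemma IsMinimal.bendingEnergy_le {Ω : Set Plane} {γ : ℝ → Plane} (hγ : IsMinimal Ω γ)
    {p v : Plane} {E : ℝ} (h : HasArc γ p v p v E) : bendingEnergy γ ≤ E := by
  obtain ⟨ℓ, x, u, w, h, hx0, hu0, hx, hu, rfl⟩ := h
  obtain ⟨η, hη, hE⟩ := h.exists_isAdmissible hγ.1 (hx.trans hx0.symm) (hu.trans hu0.symm)
  exact hE ▸ hγ.2 η hη

/-! ### Integral formulas and energy of regular closed curves -/

lemma ae_differentiableAt_of_absolutelyContinuous {f : ℝ → Plane} {a b : ℝ}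
    (hf : AbsolutelyContinuousOnInterval f a b) :
    ∀ᵐ t, t ∈ uIcc a b → DifferentiableAt ℝ f t := by
  have hc (i : Fin 2) : AbsolutelyContinuousOnInterval (fun t ↦ f t i) a b :=
    squeeze_zero (fun _ ↦ Finset.sum_nonneg fun _ _ ↦ dist_nonneg)
      (fun I ↦ Finset.sum_le_sum fun j _ ↦ by
        rw [dist_eq_norm, dist_eq_norm, ← PiLp.sub_apply]
        exact PiLp.norm_apply_le _ i) hf
  filter_upwards [(hc 0).ae_differentiableAt, (hc 1).ae_differentiableAt] with t h0 h1 ht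
  rw [differentiableAt_euclidean]
  intro i
  fin_cases i
  exacts [h0 ht, h1 ht]

/-- The difference of `f` and the primitive of its derivative is absolutely continuous with zero
derivative almost everywhere, hence constant. -/
lemma integral_deriv_of_absolutelyContinuous {f : ℝ → Plane} {a b : ℝ}
    (hf : AbsolutelyContinuousOnInterval f a b)
    (hint : ∀ c d, IntervalIntegrable (deriv f) volume c d) :
    ∀ t ∈ uIcc a b, f t = f a + ∫ s in a..t, deriv f s := by
  have hac := hf.sub (absolutelyContinuousOnInterval_integral hint a b a)
  have h0 : ∀ᵐ t, t ∈ uIcc a b →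
      HasDerivAt (fun t ↦ f t - ∫ s in a..t, deriv f s) 0 t := by
    filter_upwards [ae_differentiableAt_of_absolutelyContinuous hf,
      (hint a b).ae_hasDerivAt_integral] with t h1 h2 ht
    convert! (h1 ht).hasDerivAt.sub (h2 ht a (by simp))
    abel
  obtain ⟨C, hC⟩ := hac.const_of_ae_hasDerivAt_zero h0
  intro t ht
  have h1 := hC a (by simp)
  have h2 := hC t ht
  simp only [Pi.sub_apply, intervalIntegral.integral_same, sub_zero] at h1 h2
  rw [h1, ← h2]
  abel

lemma periodic_deriv {F : Type*} [NormedAddCommGroup F] [NormedSpace ℝ F] {f : ℝ → F} {c : ℝ}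
    (hf : Function.Periodic f c) : Function.Periodic (deriv f) c := fun t ↦ by
  rw [← deriv_comp_add_const, show (fun x ↦ f (x + c)) = f from funext hf]

namespace IsRegularClosedCurve

variable {γ : ℝ → Plane} (hγ : IsRegularClosedCurve γ)
include hγ

lemma continuous_deriv : Continuous (deriv γ) := (contDiff_one_iff_deriv.1 hγ.contDiff).2

lemma hasDerivAt (t : ℝ) : HasDerivAt γ (deriv γ t) t :=
  ((contDiff_one_iff_deriv.1 hγ.contDiff).1 t).hasDerivAt

lemma intervalIntegrable_accel (a b : ℝ) : IntervalIntegrable (deriv (deriv γ)) volume a b := by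
  refine (periodic_deriv (periodic_deriv hγ.periodic)).intervalIntegrable₀ one_ne_zero ?_ a b
  rw [intervalIntegrable_iff_integrableOn_Ioc_of_le zero_le_one]
  exact hγ.memLp.integrable one_le_two

lemma intervalIntegrable_sq (a b : ℝ) :
    IntervalIntegrable (fun t ↦ ‖deriv (deriv γ) t‖ ^ 2) volume a b := by
  have hper : Function.Periodic (fun t ↦ ‖deriv (deriv γ) t‖ ^ 2) 1 := fun t ↦ by
    simp only [periodic_deriv (periodic_deriv hγ.periodic) t]
  refine hper.intervalIntegrable₀ one_ne_zero ?_ a b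
  rw [intervalIntegrable_iff_integrableOn_Ioc_of_le zero_le_one]
  exact (memLp_two_iff_integrable_sq_norm hγ.memLp.1).1 hγ.memLp

/-- Absolute continuity is only assumed on `[0, 1]`. Since the acceleration has zero mean, velocity
minus its primitive is periodic, so its constancy extends to the line. -/
lemma deriv_eq (a b : ℝ) : deriv γ b = deriv γ a + ∫ s in a..b, deriv (deriv γ) s := by
  have hint := hγ.intervalIntegrable_accel
  have h01 := integral_deriv_of_absolutelyContinuous hγ.absolutelyContinuous hint
  rw [uIcc_of_le zero_le_one] at h01
  have hper' := periodic_deriv hγ.periodic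
  have hper : Function.Periodic
      (fun t ↦ deriv γ t - ∫ s in (0 : ℝ)..t, deriv (deriv γ) s) 1 := fun t ↦ by
    have h1 := (periodic_deriv hper').intervalIntegral_add_eq t 0
    have h2 := h01 1 ⟨zero_le_one, le_rfl⟩
    rw [show deriv γ 1 = deriv γ 0 by simpa using hper' 0, left_eq_add] at h2
    rw [zero_add, h2] at h1
    simp only
    rw [hper' t, ← intervalIntegral.integral_add_adjacent_intervals (hint 0 t) (hint t (t + 1)),
      h1, add_zero]
  have hconst (t : ℝ) : deriv γ t - ∫ s in (0 : ℝ)..t, deriv (deriv γ) s = deriv γ 0 := by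
    obtain ⟨y, hy, hty⟩ := hper.exists_mem_Ico₀ one_pos t
    rw [hty, h01 y (Ico_subset_Icc_self hy)]
    abel
  rw [← intervalIntegral.integral_interval_sub_left (hint 0 b) (hint 0 a),
    sub_eq_iff_eq_add.1 (hconst a), sub_eq_iff_eq_add.1 (hconst b)]
  abel

lemma eq_add_integral (a b : ℝ) : γ b = γ a + ∫ s in a..b, deriv γ s := by
  rw [intervalIntegral.integral_eq_sub_of_hasDerivAt (fun t _ ↦ hγ.hasDerivAt t)
    (hγ.continuous_deriv.intervalIntegrable _ _)]
  abel

lemma intervalIntegrable_density (a b : ℝ) :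
    IntervalIntegrable (fun t ↦ curvature γ t ^ 2 * ‖deriv γ t‖) volume a b := by
  have hcont : Continuous fun t ↦ 4 / ‖deriv γ t‖ ^ 3 :=
    continuous_const.div (hγ.continuous_deriv.norm.pow 3)
      fun t ↦ (pow_pos (hγ.regular t) 3).ne'
  have hb := (hγ.intervalIntegrable_sq a b).continuousOn_mul hcont.continuousOn
  refine hb.mono_fun ?_ (.of_forall fun t ↦ ?_)
  · have h1 (i : Fin 2) : Measurable fun t ↦ deriv γ t i :=
      (EuclideanSpace.proj (𝕜 := ℝ) i).continuous.measurable.comp (measurable_deriv γ)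
    have h2 (i : Fin 2) : Measurable fun t ↦ deriv (deriv γ) t i :=
      (EuclideanSpace.proj (𝕜 := ℝ) i).continuous.measurable.comp (measurable_deriv _)
    have h3 : Measurable fun t ↦ ‖deriv γ t‖ := (measurable_deriv γ).norm
    exact (((((h1 0).mul (h2 1)).sub ((h1 1).mul (h2 0))).div (h3.pow_const 3)).pow_const 2
      |>.mul h3).aestronglyMeasurable
  · have hL := hγ.regular t
    set u := deriv γ t with hu
    set w := deriv (deriv γ) t with hw
    -- By Lagrange's identity the constant `1` would do; any constant serves for integrability.
    have hcross : (u 0 * w 1 - u 1 * w 0) ^ 2 ≤ 4 * ‖u‖ ^ 2 * ‖w‖ ^ 2 := by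
      rw [EuclideanSpace.norm_sq_eq, EuclideanSpace.norm_sq_eq]
      simp only [Fin.sum_univ_two, Real.norm_eq_abs, sq_abs]
      nlinarith [sq_nonneg (u 0 * w 0 + u 1 * w 1), sq_nonneg (u 0 * w 1 - u 1 * w 0)]
    beta_reduce
    rw [Real.norm_of_nonneg (by positivity), Real.norm_of_nonneg (by positivity), curvature,
      ← hu, ← hw, div_pow]
    calc (u 0 * w 1 - u 1 * w 0) ^ 2 / (‖u‖ ^ 3) ^ 2 * ‖u‖
        ≤ 4 * ‖u‖ ^ 2 * ‖w‖ ^ 2 / (‖u‖ ^ 3) ^ 2 * ‖u‖ := by gcongr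
      _ = 4 / ‖u‖ ^ 3 * ‖w‖ ^ 2 := by field_simp

lemma arcEnergy_add (a b c : ℝ) : arcEnergy γ a b + arcEnergy γ b c = arcEnergy γ a c :=
  intervalIntegral.integral_add_adjacent_intervals (hγ.intervalIntegrable_density a b)
    (hγ.intervalIntegrable_density b c)

lemma arcEnergy_add_one (a b : ℝ) : arcEnergy γ (a + 1) (b + 1) = arcEnergy γ a b := by
  have h := intervalIntegral.integral_comp_add_right (a := a) (b := b)
    (fun t ↦ curvature γ t ^ 2 * ‖deriv γ t‖) 1
  simp only [curvature, periodic_deriv hγ.periodic _,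
    periodic_deriv (periodic_deriv hγ.periodic) _] at h
  exact h.symm

lemma arcEnergy_period (a : ℝ) : arcEnergy γ a (a + 1) = bendingEnergy γ := by
  have h := hγ.arcEnergy_add_one 0 a
  have h1 := hγ.arcEnergy_add a 0 1
  have h2 := hγ.arcEnergy_add a 1 (a + 1)
  have h3 := hγ.arcEnergy_add a 0 a
  have h4 : arcEnergy γ a a = 0 := intervalIntegral.integral_same
  rw [zero_add] at h
  rw [bendingEnergy]
  linarith

lemma hasArc {a b : ℝ} (hab : a < b) :
    HasArc γ (γ a) (deriv γ a) (γ b) (deriv γ b) (arcEnergy γ a b) := by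
  have hint {F : Type} [NormedAddCommGroup F] {f : ℝ → F} (hf : IntervalIntegrable f volume a b) :
      IntervalIntegrable (fun t ↦ f (t + a)) volume 0 (b - a) := by
    simpa using hf.comp_add_right a
  refine ⟨b - a, fun t ↦ γ (t + a), fun t ↦ deriv γ (t + a), fun t ↦ deriv (deriv γ) (t + a),
    ⟨sub_pos.2 hab, hint (hγ.intervalIntegrable_accel a b), hint (hγ.intervalIntegrable_sq a b),
      hint (hγ.continuous_deriv.intervalIntegrable a b), hint (hγ.intervalIntegrable_density a b),
      fun t _ ↦ ?_, fun t _ ↦ ?_, fun t _ ↦ ⟨t + a, rfl, .inl rfl⟩⟩, by simp, by simp, by simp,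
    by simp, ?_⟩
  · rw [intervalIntegral.integral_comp_add_right, zero_add, ← hγ.deriv_eq]
  · rw [intervalIntegral.integral_comp_add_right, zero_add, ← hγ.eq_add_integral]
  · have h := intervalIntegral.integral_comp_add_right (a := 0) (b := b - a)
      (fun t ↦ curvature γ t ^ 2 * ‖deriv γ t‖) a
    rw [zero_add, sub_add_cancel] at h
    exact h

/-- Zero energy makes the acceleration parallel to the velocity, constant speed makes it orthogonal.
It then vanishes almost everywhere, so the curve is a straight line and cannot close. -/
lemma bendingEnergy_pos {L : ℝ} (hL : ∀ t, ‖deriv γ t‖ = L) : 0 < bendingEnergy γ := by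
  have hint := hγ.intervalIntegrable_density 0 1
  have hnn : 0 ≤ fun t ↦ curvature γ t ^ 2 * ‖deriv γ t‖ := fun t ↦ by
    simp only [Pi.zero_apply]
    positivity
  refine (intervalIntegral.integral_nonneg zero_le_one fun t _ ↦ hnn t).lt_of_ne fun h0 ↦ ?_
  have hae := (intervalIntegral.integral_eq_zero_iff_of_nonneg_ae (.of_forall hnn) hint).1 h0.symm
  rw [Ioc_eq_empty (not_lt.2 zero_le_one), union_empty, Filter.EventuallyEq,
    ae_restrict_iff' measurableSet_Ioc] at hae
  have hzero : ∀ᵐ t, t ∈ uIoc (0 : ℝ) 1 → deriv (deriv γ) t = 0 := by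
    filter_upwards [hae, ae_differentiableAt_of_absolutelyContinuous hγ.absolutelyContinuous]
      with t h1 h2 ht
    have hd := (h2 (uIoc_subset_uIcc ht)).hasDerivAt
    rw [uIoc_of_le zero_le_one] at ht
    have hpos := hγ.regular t
    have hcross : deriv γ t 0 * deriv (deriv γ) t 1 - deriv γ t 1 * deriv (deriv γ) t 0 = 0 := by
      have := h1 ht
      simpa [curvature, hpos.ne', norm_pos_iff.1 hpos] using this
    have hdot : deriv γ t 0 * deriv (deriv γ) t 0 + deriv γ t 1 * deriv (deriv γ) t 1 = 0 := by
      have h3 := hd.norm_sq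
      have h4 : (fun s ↦ ‖deriv γ s‖ ^ 2) = fun _ ↦ L ^ 2 := funext fun s ↦ by rw [hL]
      have h5 := h3.unique (h4 ▸ hasDerivAt_const t (L ^ 2))
      simp [PiLp.inner_apply, Fin.sum_univ_two] at h5
      linarith
    have hsq : ‖deriv γ t‖ ^ 2 = deriv γ t 0 ^ 2 + deriv γ t 1 ^ 2 := by
      simp [EuclideanSpace.norm_sq_eq, Fin.sum_univ_two]
    have hne : ‖deriv γ t‖ ^ 2 ≠ 0 := (pow_pos hpos 2).ne'
    ext i
    refine (mul_eq_zero.1 (?_ : ‖deriv γ t‖ ^ 2 * deriv (deriv γ) t i = 0)).resolve_left hne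
    rw [hsq]
    fin_cases i
    · simp only [Fin.zero_eta]
      linear_combination deriv γ t 0 * hdot - deriv γ t 1 * hcross
    · simp only [Fin.mk_one]
      linear_combination deriv γ t 1 * hdot + deriv γ t 0 * hcross
  have hconst : ∀ t ∈ Icc (0 : ℝ) 1, deriv γ t = deriv γ 0 := fun t ht ↦ by
    rw [hγ.deriv_eq 0 t, add_eq_left]
    refine (intervalIntegral.integral_congr_ae (g := fun _ ↦ (0 : Plane)) ?_).trans (by simp)
    filter_upwards [hzero] with s hs hst
    rw [uIoc_of_le ht.1] at hst
    exact hs (by rw [uIoc_of_le zero_le_one]; exact ⟨hst.1, hst.2.trans ht.2⟩)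
  have h1 := hγ.eq_add_integral 0 1
  have h2 : ∫ s in (0 : ℝ)..1, deriv γ s = deriv γ 0 := by
    rw [intervalIntegral.integral_congr (g := fun _ ↦ deriv γ 0) fun s hs ↦
      hconst s (by rwa [uIcc_of_le zero_le_one] at hs)]
    simp
  have h3 : γ 1 = γ 0 := by simpa using hγ.periodic 0
  rw [h2, h3, left_eq_add] at h1
  exact norm_pos_iff.1 (hγ.regular 0) h1

end IsRegularClosedCurve

/-! ### Cut and paste at the contacts of a minimizer -/

/-- A minimizer of the bending energy among admissible curves, parametrized with constant speed. -/
structure IsConstantSpeedMinimal (Ω : Set Plane) (γ : ℝ → Plane) : Prop where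
  isMinimal : IsMinimal Ω γ
  constantSpeed : ∃ L : ℝ, ∀ t, ‖deriv γ t‖ = L

namespace IsConstantSpeedMinimal

variable {Ω : Set Plane} {γ : ℝ → Plane} {t s τ σ t₁ s₁ t₂ s₂ t₃ s₃ a b c : ℝ}

lemma regular (h : IsConstantSpeedMinimal Ω γ) : IsRegularClosedCurve γ :=
  h.isMinimal.1.regularClosed

lemma bendingEnergy_pos (h : IsConstantSpeedMinimal Ω γ) : 0 < bendingEnergy γ :=
  let ⟨_, hL⟩ := h.constantSpeed
  h.regular.bendingEnergy_pos hL

lemma add_one (h : IsConstantSpeedMinimal Ω γ) (t : ℝ) : γ (t + 1) = γ t := h.regular.periodic t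

lemma deriv_add_one (h : IsConstantSpeedMinimal Ω γ) (t : ℝ) : deriv γ (t + 1) = deriv γ t :=
  periodic_deriv h.regular.periodic t

lemma deriv_ne_zero (h : IsConstantSpeedMinimal Ω γ) (t : ℝ) : deriv γ t ≠ 0 :=
  norm_pos_iff.1 (h.regular.regular t)

lemma deriv_ne_neg_self (h : IsConstantSpeedMinimal Ω γ) (t : ℝ) :
    deriv γ t ≠ -deriv γ t := fun e ↦ by
  have h2 : (2 : ℝ) • deriv γ t = 0 := by rw [two_smul, add_eq_zero_iff_eq_neg, ← e]
  exact h.deriv_ne_zero t ((smul_eq_zero.1 h2).resolve_left two_ne_zero)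

/-- A contact couple splits the curve into two closed arcs. -/
lemma deriv_ne_of_contact (h : IsConstantSpeedMinimal Ω γ) (hts : t < s) (hst : s < t + 1)
    (hγ : γ t = γ s) : deriv γ s ≠ deriv γ t := fun hd ↦ by
  have h1 := h.regular.hasArc hts
  have h2 := h.regular.hasArc hst
  rw [h.add_one, h.deriv_add_one, hγ, ← hd] at h2
  rw [hγ, ← hd] at h1
  have e1 := h.isMinimal.bendingEnergy_le h1
  have e2 := h.isMinimal.bendingEnergy_le h2
  have e3 := h.regular.arcEnergy_add t s (t + 1)
  rw [h.regular.arcEnergy_period] at e3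
  linarith [h.bendingEnergy_pos]

/-- Tangency and constant speed leave only the factors `1` and `-1`. -/
lemma deriv_eq_neg (h : IsConstantSpeedMinimal Ω γ) (hts : IsContactCouple γ t s) :
    deriv γ s = -deriv γ t := by
  obtain ⟨hlt, hlt', hγ⟩ := hts
  obtain ⟨c, hc⟩ := h.isMinimal.1.tangential t s hγ
  obtain ⟨L, hL⟩ := h.constantSpeed
  have hn := congrArg norm hc
  rw [norm_smul, hL, hL, Real.norm_eq_abs, right_eq_mul₀ (hL t ▸ (h.regular.regular t).ne')] at hn
  rcases eq_or_eq_neg_of_abs_eq hn with rfl | rfl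
  · exact absurd (by simpa using hc) (h.deriv_ne_of_contact hlt hlt' hγ)
  · simpa using hc

/-- Three velocities cannot be pairwise opposite. -/
lemma not_triple_point (h : IsConstantSpeedMinimal Ω γ) (hab : a < b) (hbc : b < c) (hca : c < a + 1)
    (h1 : γ a = γ b) (h2 : γ b = γ c) : False := by
  have e1 := h.deriv_eq_neg ⟨hab, by linarith, h1⟩
  have e2 := h.deriv_eq_neg ⟨hbc, by linarith, h2⟩
  rw [e1, neg_neg] at e2
  exact h.deriv_ne_of_contact (hab.trans hbc) hca (h1.trans h2) e2

lemma not_crossing (h : IsConstantSpeedMinimal Ω γ) (h₁ : γ t₁ = γ s₁) (h₂ : γ t₂ = γ s₂)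
    (ht : t₁ < t₂) (hts : t₂ < s₁) (hs : s₁ < s₂) (hst : s₂ < t₁ + 1) : False := by
  have d₁ := h.deriv_eq_neg ⟨ht.trans hts, by linarith, h₁⟩
  have d₂ := h.deriv_eq_neg ⟨hts.trans hs, by linarith, h₂⟩
  have a₁ := h.regular.hasArc ht
  have a₂ := h.regular.hasArc hts
  have a₃ := (h.regular.hasArc hs).reverse
  have a₄ := (h.regular.hasArc hst).reverse
  rw [h.add_one, h.deriv_add_one] at a₄
  rw [d₁, d₂, neg_neg, neg_neg, ← h₁, ← h₂] at a₃
  rw [d₁, ← h₁] at a₂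
  rw [d₂, neg_neg, ← h₂] at a₄
  -- Opposite velocities at both contacts let the first arc close with the third reversed, and the
  -- second with the fourth reversed. The two competitors share the energy of `γ`, so twice that
  -- energy is at most itself.
  have e₁ := h.isMinimal.bendingEnergy_le (a₁.trans a₃)
  have e₂ := h.isMinimal.bendingEnergy_le (a₂.trans a₄)
  have e₃ := h.regular.arcEnergy_add t₁ t₂ s₁
  have e₄ := h.regular.arcEnergy_add t₁ s₁ s₂
  have e₅ := h.regular.arcEnergy_add t₁ s₂ (t₁ + 1)
  rw [h.regular.arcEnergy_period] at e₅
  linarith [h.bendingEnergy_pos]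

/-- Two drops joined by a doubled branch form a closed curve. -/
lemma bendingEnergy_le_of_contact (h : IsConstantSpeedMinimal Ω γ) (h₁ : γ t = γ s)
    (h₂ : γ τ = γ σ) (hts : t < s) (hsτ : s < τ) (hτσ : τ < σ) (hσt : σ < t + 1) :
    bendingEnergy γ ≤ arcEnergy γ t s + arcEnergy γ s τ + arcEnergy γ τ σ + arcEnergy γ s τ := by
  have d₁ := h.deriv_eq_neg ⟨hts, by linarith, h₁⟩
  have d₂ := h.deriv_eq_neg ⟨hτσ, by linarith, h₂⟩
  have a₁ := h.regular.hasArc hts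
  have a₂ := h.regular.hasArc hsτ
  have a₃ := h.regular.hasArc hτσ
  have a₄ := (h.regular.hasArc hsτ).reverse
  rw [d₁, neg_neg, ← h₁] at a₄
  rw [d₂, ← h₂] at a₃
  exact h.isMinimal.bendingEnergy_le (((a₁.trans a₂).trans a₃).trans a₄)

lemma arcEnergy_eq_of_contact (h : IsConstantSpeedMinimal Ω γ) (h₁ : γ t = γ s)
    (h₂ : γ τ = γ σ) (hts : t < s) (hsτ : s < τ) (hτσ : τ < σ) (hσt : σ < t + 1) :
    arcEnergy γ s τ = arcEnergy γ σ (t + 1) := by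
  have e₁ := h.bendingEnergy_le_of_contact h₁ h₂ hts hsτ hτσ hσt
  -- Shifting the first couple by a period exchanges the two drops, so that the other branch is
  -- doubled.
  have e₂ := h.bendingEnergy_le_of_contact (t := τ) (s := σ) (τ := t + 1) (σ := s + 1) h₂
    (by rw [h.add_one, h.add_one, h₁]) hτσ hσt (by linarith) (by linarith)
  rw [h.regular.arcEnergy_add_one] at e₂
  have e₃ := h.regular.arcEnergy_add t s τ
  have e₄ := h.regular.arcEnergy_add t τ σ
  have e₅ := h.regular.arcEnergy_add t σ (t + 1)
  rw [h.regular.arcEnergy_period] at e₅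
  linarith

/-- Three contact couples cannot cut out three disjoint drops. -/
lemma not_three_drops (h : IsConstantSpeedMinimal Ω γ) (h₁ : γ t₁ = γ s₁) (h₂ : γ t₂ = γ s₂)
    (h₃ : γ t₃ = γ s₃) (i₁ : t₁ < s₁) (i₂ : s₁ < t₂) (i₃ : t₂ < s₂) (i₄ : s₂ < t₃) (i₅ : t₃ < s₃)
    (i₆ : s₃ < t₁ + 1) : False := by
  -- With `A`, `B`, `C` the energies of the gaps following the drops, of energies `D₁`, `D₂`, `D₃`:
  -- `A = B + D₃ + C`, `B = C + D₁ + A`, `C = A + D₂ + B`. Adding them makes the total energy zero.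
  have e₁ := h.arcEnergy_eq_of_contact h₁ h₂ i₁ i₂ i₃ (by linarith)
  have e₂ := h.arcEnergy_eq_of_contact h₂ h₃ i₃ i₄ i₅ (by linarith)
  have e₃ := h.arcEnergy_eq_of_contact h₁ h₃ i₁ (by linarith) i₅ i₆
  have f₁ := h.regular.arcEnergy_add t₁ s₁ t₂
  have f₂ := h.regular.arcEnergy_add t₁ t₂ s₂
  have f₃ := h.regular.arcEnergy_add t₁ s₂ t₃
  have f₄ := h.regular.arcEnergy_add t₁ t₃ s₃
  have f₅ := h.regular.arcEnergy_add t₁ s₃ (t₁ + 1)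
  have f₆ := h.regular.arcEnergy_add t₁ s₂ (t₁ + 1)
  have f₇ := h.regular.arcEnergy_add s₁ t₂ s₂
  have f₈ := h.regular.arcEnergy_add s₁ s₂ t₃
  have f₉ := h.regular.arcEnergy_add s₃ (t₁ + 1) (t₂ + 1)
  have f₀ := h.regular.arcEnergy_add_one t₁ t₂
  have hp := h.bendingEnergy_pos
  rw [h.regular.arcEnergy_period] at f₅ f₆
  linarith

/-! ### Multiplicity and nesting -/

lemma encard_le_two (h : IsConstantSpeedMinimal Ω γ) (x : Plane) :
    {t ∈ Ico (0 : ℝ) 1 | γ t = x}.encard ≤ 2 := by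
  by_contra! hc
  have h3 : (3 : ℕ∞) ≤ {t ∈ Ico (0 : ℝ) 1 | γ t = x}.encard := by
    simpa [two_add_one_eq_three] using Order.add_one_le_of_lt hc
  obtain ⟨A, hA, hA3⟩ := exists_subset_encard_eq h3
  obtain ⟨a, b, c, hab, hac, hbc, rfl⟩ := encard_eq_three.1 hA3
  have ha := hA (show a ∈ _ by simp)
  have hb := hA (show b ∈ _ by simp)
  have hc := hA (show c ∈ _ by simp)
  have key : ∀ {a b : ℝ}, a ∈ Ico (0 : ℝ) 1 ∧ γ a = x → b ∈ Ico (0 : ℝ) 1 ∧ γ b = x → a ≠ b →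
      deriv γ b = -deriv γ a := by
    intro a b ha hb hab
    rcases hab.lt_or_gt with hlt | hlt
    · exact h.deriv_eq_neg ⟨hlt, by linarith [ha.1.1, hb.1.2], ha.2.trans hb.2.symm⟩
    · rw [h.deriv_eq_neg ⟨hlt, by linarith [ha.1.2, hb.1.1], hb.2.trans ha.2.symm⟩, neg_neg]
  have e := key hb hc hbc
  rw [key ha hc hac, key ha hb hab, neg_neg] at e
  exact h.deriv_ne_neg_self a e.symm

/-- Every contact point is attained at two distinct times of a period. -/
lemma exists_contact (h : IsConstantSpeedMinimal Ω γ) {x : Plane} (hx : x ∈ contactPoints γ) :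
    ∃ t s, 0 ≤ t ∧ t < s ∧ s < 1 ∧ γ t = x ∧ γ s = x := by
  obtain ⟨t, ⟨s, hts, hst, hγ⟩, rfl⟩ := hx
  have hfr (t : ℝ) : γ (Int.fract t) = γ t := by
    rw [Int.fract]
    simpa using h.regular.periodic.sub_int_mul_eq (x := t) ⌊t⌋
  have hne : Int.fract t ≠ Int.fract s := fun he ↦ by
    obtain ⟨n, hn⟩ := Int.fract_eq_fract.1 he
    have h1 : ((-1 : ℤ) : ℝ) < n := by rw [← hn]; push_cast; linarith
    have h2 : (n : ℝ) < (0 : ℤ) := by rw [← hn]; push_cast; linarith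
    have := Int.cast_lt.1 h1
    have := Int.cast_lt.1 h2
    omega
  rcases hne.lt_or_gt with hlt | hlt
  · exact ⟨_, _, Int.fract_nonneg _, hlt, Int.fract_lt_one _, hfr t, (hfr s).trans hγ.symm⟩
  · exact ⟨_, _, Int.fract_nonneg _, hlt, Int.fract_lt_one _, (hfr s).trans hγ.symm, hfr t⟩

lemma exists_nested (h : IsConstantSpeedMinimal Ω γ) (x : Fin 3 → Plane)
    (hinj : Function.Injective x) (hx : ∀ i, x i ∈ contactPoints γ) :
    ∃ (π : Equiv.Perm (Fin 3)) (t s : Fin 3 → ℝ),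
      t 0 < t 1 ∧ t 1 < t 2 ∧ t 2 < s 2 ∧ s 2 < s 1 ∧ s 1 < s 0 ∧ s 0 < t 0 + 1 ∧
      ∀ i, γ (t i) = x (π i) ∧ γ (s i) = x (π i) := by
  choose T S h0 hTS h1 hT hS using fun i ↦ h.exists_contact (hx i)
  have hne : ∀ i j, i ≠ j → T i ≠ T j ∧ S i ≠ S j ∧ S i ≠ T j := fun i j hij ↦ by
    refine ⟨fun e ↦ ?_, fun e ↦ ?_, fun e ↦ ?_⟩ <;> apply hinj.ne hij
    · rw [← hT i, ← hT j, e]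
    · rw [← hS i, ← hS j, e]
    · rw [← hS i, ← hT j, e]
  have hcross : ∀ i j, T i < T j → T j < S i → S i < S j → False := fun i j ↦
    fun a b c ↦ h.not_crossing ((hT i).trans (hS i).symm) ((hT j).trans (hS j).symm) a b c
      (by linarith [h0 i, h1 j])
  have hTinj : Function.Injective T := fun i j hij ↦ by
    by_contra hc
    exact (hne i j hc).1 hij
  set ρ := Tuple.sort T with hρ
  have hmono : StrictMono (T ∘ ρ) :=
    (Tuple.monotone_sort T).strictMono_of_injective (hTinj.comp ρ.injective)
  have t01 : T (ρ 0) < T (ρ 1) := hmono (by decide : (0 : Fin 3) < 1)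
  have t12 : T (ρ 1) < T (ρ 2) := hmono (by decide : (1 : Fin 3) < 2)
  have n01 := hne (ρ 0) (ρ 1) (ρ.injective.ne (by decide))
  have n02 := hne (ρ 0) (ρ 2) (ρ.injective.ne (by decide))
  have n12 := hne (ρ 1) (ρ 2) (ρ.injective.ne (by decide))
  have c01 := hcross (ρ 0) (ρ 1) t01
  have c02 := hcross (ρ 0) (ρ 2) (t01.trans t12)
  have c12 := hcross (ρ 1) (ρ 2) t12
  have hc (i : Fin 3) : γ (T (ρ i)) = γ (S (ρ i)) := (hT _).trans (hS _).symm
  have hc' (i : Fin 3) : γ (S (ρ i)) = γ (T (ρ i) + 1) := by rw [h.add_one, hc]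
  have b0 := h0 (ρ 0)
  have b1 := h1 (ρ 1)
  have b2 := h1 (ρ 2)
  have l0 := hTS (ρ 0)
  have l1 := hTS (ρ 1)
  have l2 := hTS (ρ 2)
  have hT' (i : Fin 3) : γ (T (ρ i) + 1) = x (ρ i) := by rw [h.add_one, hT]
  -- Without crossings, two of the intervals `[T, S]` are disjoint or nested. A couple may be
  -- replaced by its complement `(S, T + 1)`, which turns every configuration into a chain unless it
  -- shows three disjoint drops.
  rcases n01.2.2.lt_or_gt with i01 | i01
  · rcases n12.2.2.lt_or_gt with i12 | i12
    · exact (h.not_three_drops (hc 0) (hc 1) (hc 2) l0 i01 l1 i12 l2 (by linarith)).elim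
    · have i12' : S (ρ 2) < S (ρ 1) := n12.2.1.lt_or_gt.resolve_left (c12 i12)
      refine ⟨ρ, ![S (ρ 0), T (ρ 1), T (ρ 2)], ![T (ρ 0) + 1, S (ρ 1), S (ρ 2)],
        i01, t12, l2, i12', by simp; linarith, by simpa using l0, fun i ↦ ?_⟩
      fin_cases i
      exacts [⟨hS _, hT' 0⟩, ⟨hT _, hS _⟩, ⟨hT _, hS _⟩]
  · have i01' : S (ρ 1) < S (ρ 0) := n01.2.1.lt_or_gt.resolve_left (c01 i01)
    rcases n12.2.2.lt_or_gt with i12 | i12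
    · rcases n02.2.2.lt_or_gt with i02 | i02
      · refine ⟨(Equiv.swap 0 1).trans ρ, ![S (ρ 1), S (ρ 0), T (ρ 2)],
          ![T (ρ 1) + 1, T (ρ 0) + 1, S (ρ 2)],
          i01', i02, l2, by simp; linarith, by simpa using t01, by simpa using l1, fun i ↦ ?_⟩
        fin_cases i
        exacts [⟨hS _, hT' 1⟩, ⟨hS _, hT' 0⟩, ⟨hT _, hS _⟩]
      · have i02' : S (ρ 2) < S (ρ 0) := n02.2.1.lt_or_gt.resolve_left (c02 i02)
        exact (h.not_three_drops (hc 1) (hc 2) (hc' 0) l1 i12 l2 i02' (by linarith [h1 (ρ 0)])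
          (by linarith)).elim
    · have i12' : S (ρ 2) < S (ρ 1) := n12.2.1.lt_or_gt.resolve_left (c12 i12)
      refine ⟨ρ, ![T (ρ 0), T (ρ 1), T (ρ 2)], ![S (ρ 0), S (ρ 1), S (ρ 2)],
        t01, t12, l2, i12', i01', by simp; linarith [h1 (ρ 0)], fun i ↦ ?_⟩
      fin_cases i
      exacts [⟨hT _, hS _⟩, ⟨hT _, hS _⟩, ⟨hT _, hS _⟩]

/-! ### Innermost couples and the two drops -/

/-- Every contact couple encloses an innermost one. -/
lemma exists_innermost (h : IsConstantSpeedMinimal Ω γ) (hab : IsContactCouple γ a b) :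
    ∃ t s, a ≤ t ∧ s ≤ b ∧ IsContactCouple γ t s ∧ Ioo t s ∩ contactTimes γ = ∅ := by
  -- The velocity condition is closed and holds at every couple, but fails on the diagonal. So a
  -- minimizer of `s - t` on the compact set `K` is a genuine couple.
  set K : Set (ℝ × ℝ) := {p | a ≤ p.1 ∧ p.1 ≤ p.2 ∧ p.2 ≤ b ∧ γ p.1 = γ p.2 ∧
    deriv γ p.2 = -deriv γ p.1} with hK
  have hcont : Continuous γ := h.regular.contDiff.continuous
  have hcont' := h.regular.continuous_deriv
  have hclosed : IsClosed K := by
    refine (isClosed_le continuous_const continuous_fst).inter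
      ((isClosed_le continuous_fst continuous_snd).inter
        ((isClosed_le continuous_snd continuous_const).inter
          ((isClosed_eq (hcont.comp continuous_fst) (hcont.comp continuous_snd)).inter
            (isClosed_eq (hcont'.comp continuous_snd) (hcont'.comp continuous_fst).neg))))
  have hcomp : IsCompact K := (isCompact_Icc.prod isCompact_Icc).of_isClosed_subset hclosed
    fun p hp ↦ (⟨⟨hp.1, hp.2.1.trans hp.2.2.1⟩, ⟨hp.1.trans hp.2.1, hp.2.2.1⟩⟩ :
      p ∈ Icc a b ×ˢ Icc a b)
  obtain ⟨⟨t, s⟩, ⟨hat, hts, hsb, hγ, hd⟩, hmin⟩ := hcomp.exists_isMinOn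
    ⟨(a, b), le_rfl, hab.1.le, le_rfl, hab.2.2, h.deriv_eq_neg hab⟩
    (continuous_snd.sub continuous_fst).continuousOn
  simp only at hat hts hsb hγ hd
  have hts' : t < s := hts.lt_of_ne fun e ↦ by
    rw [e] at hd
    exact h.deriv_ne_neg_self s hd
  have hst : s < t + 1 := by linarith [hab.2.1]
  have hmin' : ∀ c d, t < c → c < d → d < s → γ c = γ d → False := fun c d h1 h2 h3 h4 ↦ by
    have := isMinOn_iff.1 hmin (c, d) ⟨by simp only; linarith, h2.le, by simp only; linarith, h4,
      h.deriv_eq_neg ⟨h2, by linarith, h4⟩⟩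
    simp only [Pi.sub_apply] at this
    linarith
  refine ⟨t, s, hat, hsb, ⟨hts', hst, hγ⟩, ?_⟩
  rw [eq_empty_iff_forall_notMem]
  rintro c ⟨⟨htc, hcs⟩, d, hcd, hdc, hγ'⟩
  -- The partner `d` of an inner contact time `c` gives a shorter couple, a triple point or a
  -- crossing; past `t + 1`, its translate `d - 1` gives a shorter couple.
  rcases lt_trichotomy d s with hds | rfl | hds
  · exact hmin' c d htc hcd hds hγ'
  · exact h.not_triple_point htc hcs hst (hγ.trans hγ'.symm) hγ'
  · rcases lt_trichotomy d (t + 1) with hdt | rfl | hdt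
    · exact h.not_crossing hγ hγ' htc hcs hds hdt
    · rw [h.add_one] at hγ'
      exact h.not_triple_point htc hcs hst hγ'.symm (hγ'.trans hγ)
    · have hd1 := h.add_one (d - 1)
      rw [sub_add_cancel] at hd1
      exact hmin' (d - 1) c (by linarith) (by linarith) hcs (by rw [← hd1, hγ'])

lemma add_one_mem_contactTimes (h : IsConstantSpeedMinimal Ω γ) :
    t + 1 ∈ contactTimes γ ↔ t ∈ contactTimes γ := by
  constructor
  · rintro ⟨s, h1, h2, h3⟩
    refine ⟨s - 1, by linarith, by linarith, ?_⟩
    have := h.add_one (s - 1)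
    rw [sub_add_cancel] at this
    rw [← this, ← h3, h.add_one]
  · rintro ⟨s, h1, h2, h3⟩
    exact ⟨s + 1, by linarith, by linarith, by rw [h.add_one, h.add_one, h3]⟩

lemma contactCouple_swap (h : IsConstantSpeedMinimal Ω γ) (hts : IsContactCouple γ t s) :
    IsContactCouple γ s (t + 1) :=
  ⟨hts.2.1, by linarith [hts.1], by rw [h.add_one, hts.2.2]⟩

lemma exists_two_drops (h : IsConstantSpeedMinimal Ω γ) (hn : (contactPoints γ).Nontrivial) :
    ∃ t s τ σ : ℝ, t < s ∧ s < τ ∧ τ < σ ∧ σ < t + 1 ∧ IsContactCouple γ t s ∧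
      IsContactCouple γ τ σ ∧ Ioo t s ∩ contactTimes γ = ∅ ∧ Ioo τ σ ∩ contactTimes γ = ∅ := by
  obtain ⟨-, a, ⟨b, hab⟩, -⟩ := hn.nonempty
  obtain ⟨t, s, -, -, hts, he⟩ := h.exists_innermost hab
  obtain ⟨-, ⟨c₀, hc₀, rfl⟩, hne⟩ := hn.exists_ne (γ t)
  -- Pairing the position with membership lets a single shift preserve both.
  have hper : Function.Periodic (fun t ↦ (γ t, t ∈ contactTimes γ)) 1 := fun t ↦ by
    simp only [h.add_one, h.add_one_mem_contactTimes]
  obtain ⟨c, ⟨hsc, hcs⟩, hc⟩ := hper.exists_mem_Ico one_pos c₀ s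
  obtain ⟨hγc, hmem⟩ := Prod.mk.inj hc
  rw [hγc] at hne
  have hsep : ∀ r ∈ contactTimes γ, γ r = γ c → r ≤ t + 1 ∨ s + 1 ≤ r → r < t + 1 ∨ s + 1 < r := by
    rintro r - hr (hle | hle)
    · refine .inl (hle.lt_of_ne fun e ↦ hne ?_)
      rw [← hr, e, h.add_one]
    · refine .inr (hle.lt_of_ne fun e ↦ hne ?_)
      rw [← hr, ← e, h.add_one, hts.2.2]
  have hout : ∀ r ∈ contactTimes γ, γ r = γ c → r < t + 1 ∨ s + 1 < r := fun r hr hγr ↦ by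
    refine hsep r hr hγr ?_
    by_contra! hcon
    have hr' : r - 1 ∈ Ioo t s ∩ contactTimes γ :=
      ⟨⟨by linarith, by linarith⟩, h.add_one_mem_contactTimes.1 (by rwa [sub_add_cancel])⟩
    rwa [he] at hr'
  have hcmem : c ∈ contactTimes γ := hmem ▸ hc₀
  obtain ⟨d, hcd⟩ := hcmem
  have hct : c < t + 1 := (hout c ⟨d, hcd⟩ rfl).resolve_right (by linarith)
  have hsc' : s < c := hsc.lt_of_ne fun e ↦ hne (by rw [← e, hts.2.2])
  -- The partner `d` avoids the translated drop `[t + 1, s + 1]`: before it, `(c, d)` lies in the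
  -- complement of the first drop; after it, `(d - 1, c)` does.
  obtain ⟨e, f, hse, hft, hef⟩ : ∃ e f, s < e ∧ f < t + 1 ∧ IsContactCouple γ e f := by
    rcases hout d ⟨_, h.contactCouple_swap hcd⟩ hcd.2.2.symm with hd | hd
    · exact ⟨c, d, hsc', hd, hcd⟩
    · refine ⟨d - 1, c, by linarith, hct, by linarith [hcd.2.1], by linarith [hcd.1], ?_⟩
      rw [hcd.2.2, ← h.add_one (d - 1), sub_add_cancel]
  obtain ⟨τ, σ, heτ, hσf, hτσ, he'⟩ := h.exists_innermost hef
  exact ⟨t, s, τ, σ, hts.1, by linarith, hτσ.1, by linarith, hts, hτσ, he, he'⟩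

end IsConstantSpeedMinimal

end ConfinedElastica

/-! ### Assembly of the theorem -/

theorem mainTheorem3 (Ω : Set ConfinedElastica.Plane) (hΩ_open : IsOpen Ω)
    (hΩ_bounded : Bornology.IsBounded Ω) (γ : ℝ → ConfinedElastica.Plane)
    (hγ : ConfinedElastica.IsMinimal Ω γ)
    (hspeed : ∃ L : ℝ, ∀ t, ‖deriv γ t‖ = L) :
    -- every point of the curve has multiplicity at most two
    (∀ x : ConfinedElastica.Plane, {t ∈ Set.Ico (0 : ℝ) 1 | γ t = x}.encard ≤ 2) ∧
    -- the two branches at a self-contact point have opposite tangents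
    (∀ t s, ConfinedElastica.IsContactCouple γ t s → deriv γ s = -deriv γ t) ∧
    -- self-contact couples do not cross
    (∀ t₁ s₁ t₂ s₂, ConfinedElastica.IsContactCouple γ t₁ s₁ →
      ConfinedElastica.IsContactCouple γ t₂ s₂ →
      ¬ (t₁ < t₂ ∧ t₂ < s₁ ∧ s₁ < s₂ ∧ s₂ < t₁ + 1)) ∧
    -- self-contact couples are nested, up to a circular permutation
    (∀ x : Fin 3 → ConfinedElastica.Plane, Function.Injective x →
      (∀ i, x i ∈ ConfinedElastica.contactPoints γ) →
      ∃ (π : Equiv.Perm (Fin 3)) (t s : Fin 3 → ℝ),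
        t 0 < t 1 ∧ t 1 < t 2 ∧ t 2 < s 2 ∧ s 2 < s 1 ∧ s 1 < s 0 ∧ s 0 < t 0 + 1 ∧
        ∀ i, γ (t i) = x (π i) ∧ γ (s i) = x (π i)) ∧
    -- decomposition into two drops joined by two branches of equal energy
    ((ConfinedElastica.contactPoints γ).Nontrivial →
      ∃ t s τ σ : ℝ, t < s ∧ s < τ ∧ τ < σ ∧ σ < t + 1 ∧
        ConfinedElastica.IsContactCouple γ t s ∧
        ConfinedElastica.IsContactCouple γ τ σ ∧
        Set.Ioo t s ∩ ConfinedElastica.contactTimes γ = ∅ ∧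
        Set.Ioo τ σ ∩ ConfinedElastica.contactTimes γ = ∅ ∧
        Set.InjOn γ (Set.Ioo s τ) ∧
        Set.InjOn γ (Set.Ioo σ (t + 1)) ∧
        ConfinedElastica.arcEnergy γ s τ = ConfinedElastica.arcEnergy γ σ (t + 1) ∧
        (∀ a ∈ Set.Ioo s τ, ∀ b ∈ Set.Ioo σ (t + 1), γ a = γ b →
          ConfinedElastica.arcEnergy γ s a = ConfinedElastica.arcEnergy γ b (t + 1) ∧
          ConfinedElastica.arcEnergy γ a τ = ConfinedElastica.arcEnergy γ σ b) ∧
        (∀ a ∈ Set.Ioo s τ, ∀ a' ∈ Set.Ioo s τ, ∀ b ∈ Set.Ioo σ (t + 1),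
          ∀ b' ∈ Set.Ioo σ (t + 1), a < a' → γ a = γ b → γ a' = γ b' →
          b' < b ∧ ConfinedElastica.arcEnergy γ a a' = ConfinedElastica.arcEnergy γ b' b)) := by
  
  have h : ConfinedElastica.IsConstantSpeedMinimal Ω γ := ⟨hγ, hspeed⟩
  refine ⟨h.encard_le_two, fun t s hts ↦ h.deriv_eq_neg hts,
    fun t₁ s₁ t₂ s₂ h₁ h₂ hlt ↦
      h.not_crossing h₁.2.2 h₂.2.2 hlt.1 hlt.2.1 hlt.2.2.1 hlt.2.2.2,
    h.exists_nested, fun hn ↦ ?_⟩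
  obtain ⟨t, s, τ, σ, hts, hsτ, hτσ, hσt, h₁, h₂, he₁, he₂⟩ := h.exists_two_drops hn
  have hinj : Set.InjOn γ (Set.Ioo s τ) := by
    have key : ∀ a ∈ Set.Ioo s τ, ∀ b ∈ Set.Ioo s τ, γ a = γ b → ¬ a < b :=
      fun a ha b hb hab hlt ↦
        h.not_three_drops h₁.2.2 hab h₂.2.2 hts ha.1 hlt hb.2 hτσ hσt
    exact fun a ha b hb hab ↦
      le_antisymm (not_lt.1 (key b hb a ha hab.symm)) (not_lt.1 (key a ha b hb hab))
  have hinj' : Set.InjOn γ (Set.Ioo σ (t + 1)) := by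
    have key : ∀ a ∈ Set.Ioo σ (t + 1), ∀ b ∈ Set.Ioo σ (t + 1), γ a = γ b → ¬ a < b :=
      fun a ha b hb hab hlt ↦
        h.not_three_drops h₁.2.2 h₂.2.2 hab hts hsτ hτσ ha.1 hlt hb.2
    exact fun a ha b hb hab ↦
      le_antisymm (not_lt.1 (key b hb a ha hab.symm)) (not_lt.1 (key a ha b hb hab))
  have hback (b : ℝ) : γ (b - 1) = γ b := by rw [← h.add_one (b - 1), sub_add_cancel]
  refine ⟨t, s, τ, σ, hts, hsτ, hτσ, hσt, h₁, h₂, he₁, he₂, hinj, hinj',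
    h.arcEnergy_eq_of_contact h₁.2.2 h₂.2.2 hts hsτ hτσ hσt, fun a ha b hb hab ↦ ⟨?_, ?_⟩,
    fun a ha a' ha' b hb b' hb' haa' hab hab' ↦ ?_⟩
  · exact h.arcEnergy_eq_of_contact h₁.2.2 hab hts ha.1 (by linarith [ha.2, hb.1]) hb.2
  -- The couple `(b - 1, a)` encloses the first drop and acts as a larger drop opposite `(τ, σ)`;
  -- below it is opposed to `(a', b')`.
  · have e := h.arcEnergy_eq_of_contact (t := b - 1) ((hback b).trans hab.symm) h₂.2.2
      (by linarith [ha.1, hb.2]) ha.2 hτσ (by linarith [hb.1])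
    rwa [sub_add_cancel] at e
  · have hbb' : b' < b := by
      rcases lt_trichotomy b' b with hlt | rfl | hlt
      · exact hlt
      · exact absurd (hinj ha ha' (hab.trans hab'.symm)) haa'.ne
      · exact (h.not_crossing hab hab' haa' (by linarith [ha'.2, hb.1]) hlt
          (by linarith [hb'.2, ha.1])).elim
    refine ⟨hbb', ?_⟩
    have e := h.arcEnergy_eq_of_contact (t := b - 1) ((hback b).trans hab.symm) hab'
      (by linarith [ha.1, hb.2]) haa' (by linarith [ha'.2, hb'.1]) (by linarith)
    rwa [sub_add_cancel] at e
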